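/- Let $p\in[1,\infty]$ (with $2^{1/\infty}=1$). For random variables $U,V$ with values in finite label sets $\mathcal U,\mathcal V$, identify labels with their one-hot vectors and put $I_W(U,V)=W_1\big(p(U,V),\,p(U)p(V)\big)$, the Wasserstein 1-distance between the joint law and the product of the marginal laws, where the ground metric on $\mathcal U\times\mathcal V\subset\mathbb R^{|\mathcal U|+|\mathcal V|}$ is the one induced by the $p$-norm. Let $X$ be a random example with values in a measurable space $\mathcal X$, and let $A\in\{0,1\}$ be its sensitive attribute. Let $\mathcal H$ be a class of measurable functions $h:\mathcal X\to\{0,1\}$ (the candidate demonic models) of VC dimension $d<\infty$. Assume that $\mathcal H$ satisfies the usual measurability condition: for every $k$ and every $b\in\{0,1\}^k$, the set of $(x_1,\dots,x_k)\in\mathcal X^k$ such that some $h\in\mathcal H$ has $h(x_i)=b_i$ for all $i$ is measurable up to null sets for the law of $k$ independent copies of $X$. Let $(x_1,a_1),\dots,(x_m,a_m)$ be i.i.d. examples with the law of $(X,A)$, where $m\ge 1$ and $d\le 2m$, and let $\hat\varepsilon(h)=\frac1m\,|\{i: h(x_i)\ne a_i\}|$ be the empirical risk of $h$. Let $\delta\in(0,1)$,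 and let $\mathcal Y$ be a finite label set. Then, with probability at least $1-\delta$ over the training sample, for every $h\in\mathcal H$, with predicted attribute $\hat A=h(X)$, and for every $\mathcal Y$-valued predicted label $\hat Y$ (a random variable defined jointly with $X$ and $A$), $$I_W(\hat Y,A)\;\le\; I_W(\hat Y,\hat A)+2\cdot 2^{1/p}\left(\hat\varepsilon(h)+\sqrt{\frac4m\left(d\log\frac{2em}{d}+\log\frac4\delta\right)}\right),$$ where $d\log\frac{2em}{d}$ is read as $0$ for $d=0$. -/

import Mathlib

open MeasureTheory ProbabilityTheory
open scoped ENNReal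

/-! ### Wasserstein distance and Wasserstein dependency measure -/

/-- The set of couplings of `μ` and `ν`: measures on the product with marginals `μ` and `ν`. -/
def couplings {α : Type*} [MeasurableSpace α] (μ ν : Measure α) : Set (Measure (α × α)) :=
  {γ | γ.map Prod.fst = μ ∧ γ.map Prod.snd = ν}

/-- The Wasserstein 1-distance with ground cost `c`: the infimum of the transport cost over all
couplings. -/
noncomputable def wasserstein1 {α : Type*} [MeasurableSpace α] (c : α → α → ℝ≥0∞)
    (μ ν : Measure α) : ℝ≥0∞ :=
  ⨅ γ ∈ couplings μ ν, ∫⁻ z, c z.1 z.2 ∂γ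

/-- The one-hot encoding of a pair of labels: the concatenation of the one-hot vectors of `w.1`
and `w.2`, as a vector of `ℝ^(|𝒰| + |𝒱|)` with the `p`-norm. -/
noncomputable def oneHotPair (p : ℝ≥0∞) {𝒰 𝒱 : Type*} [DecidableEq 𝒰] [DecidableEq 𝒱]
    (w : 𝒰 × 𝒱) : PiLp p (fun _ : 𝒰 ⊕ 𝒱 => ℝ) :=
  WithLp.toLp p (Sum.elim (Pi.single w.1 1) (Pi.single w.2 1))

/-- The ground metric on pairs of labels: the `p`-norm distance of the one-hot encodings. -/
noncomputable def groundCost (p : ℝ≥0∞) [Fact (1 ≤ p)] {𝒰 𝒱 : Type*} [Fintype 𝒰] [Fintype 𝒱]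
    [DecidableEq 𝒰] [DecidableEq 𝒱] (w w' : 𝒰 × 𝒱) : ℝ≥0∞ :=
  ENNReal.ofReal ‖oneHotPair p w - oneHotPair p w'‖

/-- The Wasserstein dependency measure `I_W(U, V) = W₁(p(U, V), p(U) p(V))` of two random labels,
with the `p`-norm of one-hot encodings as ground metric. -/
noncomputable def wassersteinDependency (p : ℝ≥0∞) [Fact (1 ≤ p)] {Ω 𝒰 𝒱 : Type*}
    [MeasurableSpace Ω] [Fintype 𝒰] [Fintype 𝒱] [DecidableEq 𝒰] [DecidableEq 𝒱]
    [MeasurableSpace 𝒰] [MeasurableSpace 𝒱] (P : Measure Ω) (U : Ω → 𝒰) (V : Ω → 𝒱) : ℝ≥0∞ :=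
  wasserstein1 (groundCost p) (P.map fun ω => (U ω, V ω)) ((P.map U).prod (P.map V))

/-! ### Hypothesis classes -/

/-- The hypothesis class `H` shatters the finite set `s`: every labelling of `s` is realised by
some member of `H`. -/
def ClassShatters {𝒳 : Type*} (H : Set (𝒳 → Bool)) (s : Finset 𝒳) : Prop :=
  ∀ b : 𝒳 → Bool, ∃ h ∈ H, ∀ x ∈ s, h x = b x

/-- The Vapnik-Chervonenkis dimension: the supremum of the sizes of the finite shattered sets. -/
noncomputable def classVCDim {𝒳 : Type*} (H : Set (𝒳 → Bool)) : ℕ∞ :=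
  ⨆ (s : Finset 𝒳) (_ : ClassShatters H s), (s.card : ℕ∞)

/-- The measurability condition on a (possibly uncountable) hypothesis class under which
probabilities of events quantified over the class make sense: its members are measurable, and for
every labelling pattern `b` of length `k`, the event that some member of the class realises `b`
on `k` independent draws from `ν` is measurable up to null sets. -/
def MeasurableClass {𝒳 : Type*} [MeasurableSpace 𝒳] (ν : Measure 𝒳) (H : Set (𝒳 → Bool)) : Prop :=
  (∀ h ∈ H, Measurable h) ∧
    ∀ (k : ℕ) (b : Fin k → Bool),
      NullMeasurableSet {x : Fin k → 𝒳 | ∃ h ∈ H, ∀ i, h (x i) = b i} (Measure.pi fun _ => ν)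

/-- The empirical risk of `h` (for the 0-1 loss) on the labelled sample `s` of size `m`. -/
noncomputable def empiricalRisk {𝒳 : Type*} {m : ℕ} (s : Fin m → 𝒳 × Bool) (h : 𝒳 → Bool) : ℝ :=
  (∑ i, if h (s i).1 ≠ (s i).2 then (1 : ℝ) else 0) / m

/-!
Write `μ` for the law of `(X, A)` and `r(h) = P(h(X) ≠ A)` for the true risk of `h`.

*Population part.* For every random label `U`, replacing `V'` by `V` changes `I_W(U, V')` by at most
`2 * 2 ^ (1 / p) * P(V ≠ V')` (`wassersteinDependency_le_add`). By the triangle inequality for the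
Wasserstein distance (`wasserstein1_triangle`, through the gluing of couplings) it suffices to move
the joint law and the product of the marginals separately. Both moves are done by the coupling that
keeps `U` and replaces `V'` by `V`; it pays only where the two differ, and then the one-hot
encodings differ by one in exactly two coordinates, at `p`-norm distance `2 ^ (1 / p)`. With
`V = A` and `V' = h(X)` the loss is governed by `r(h)`.

*Sample part.* With probability at least `1 - δ`, every `h ∈ H` satisfies `r(h) ≤ ε̂(h) + ε`, where
`ε` is the square root in the theorem (`measure_exists_trueRisk_gt_le_delta`). This is the argument
of Vapnik and Chervonenkis. A second sample has empirical risk at least `r(h) - ε / 4` with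
probability at least one half (`half_le_measure_trueRisk_sub_le`), so the probability of failure is at most
twice the probability that the two samples differ by `3 ε / 4` on some `h`
(`measure_exists_trueRisk_gt_le`). Exchanging the two copies of each example at random preserves the
law of the double sample, and for a fixed double sample the Sauer-Shelah lemma
(`card_realizedPatterns_le`, `sum_choose_le_exp`), a union bound and Hoeffding's inequality for
random signs (`card_sum_signs_ge_le`) bound the proportion of exchanges that produce such a gap.
Only the gap event is determined by labellings of finitely many points and hence null measurable;
the failure event itself is estimated in outer measure, and its complement is replaced by a
measurable subset at the end.
-/

/-! ### The Wasserstein distance -/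

/-- The joint law of two random variables is a coupling of their laws, so its transport cost bounds
the Wasserstein distance of the laws. -/
lemma wasserstein1_map_le_lintegral {Ω α : Type*} [MeasurableSpace Ω] [MeasurableSpace α]
    {c : α → α → ℝ≥0∞} (hc : Measurable (Function.uncurry c)) (P : Measure Ω) {f g : Ω → α}
    (hf : Measurable f) (hg : Measurable g) :
    wasserstein1 c (P.map f) (P.map g) ≤ ∫⁻ ω, c (f ω) (g ω) ∂P := by
  have hfg : Measurable fun ω => (f ω, g ω) := hf.prodMk hg
  have hmem : P.map (fun ω => (f ω, g ω)) ∈ couplings (P.map f) (P.map g) :=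
    ⟨Measure.map_map measurable_fst hfg, Measure.map_map measurable_snd hfg⟩
  exact (iInf₂_le _ hmem).trans_eq (lintegral_map (f := fun z : α × α => c z.1 z.2) hc hfg)

/-- The gluing lemma: two couplings with a common middle marginal are the two-dimensional marginals
of a single measure. -/
lemma exists_gluing {α : Type*} [MeasurableSpace α] [StandardBorelSpace α] [Nonempty α]
    (γ₁ γ₂ : Measure (α × α)) [IsFiniteMeasure γ₁] [IsFiniteMeasure γ₂]
    (h : γ₁.map Prod.snd = γ₂.map Prod.fst) :
    ∃ Γ : Measure ((α × α) × α), Γ.map Prod.fst = γ₁ ∧ Γ.map (fun z => (z.1.2, z.2)) = γ₂ := by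
  refine ⟨γ₁ ⊗ₘ (γ₂.condKernel.comap Prod.snd measurable_snd), Measure.fst_compProd _ _, ?_⟩
  conv_rhs => rw [← γ₂.disintegrate γ₂.condKernel]
  ext s hs
  have hm : Measurable fun z : (α × α) × α => (z.1.2, z.2) := by fun_prop
  rw [Measure.map_apply hm hs, Measure.compProd_apply (hm hs), Measure.compProd_apply hs,
    Measure.fst, ← h, lintegral_map (Kernel.measurable_kernel_prodMk_left hs) measurable_snd]
  rfl

/-- The triangle inequality for the Wasserstein distance. -/
lemma wasserstein1_triangle {α : Type*} [MeasurableSpace α] [StandardBorelSpace α] [Nonempty α]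
    {c : α → α → ℝ≥0∞} (hc : Measurable (Function.uncurry c))
    (htri : ∀ x y z, c x z ≤ c x y + c y z) (μ ν ρ : Measure α) [IsFiniteMeasure ν] :
    wasserstein1 c μ ρ ≤ wasserstein1 c μ ν + wasserstein1 c ν ρ := by
  simp only [wasserstein1, ENNReal.iInf_add, ENNReal.add_iInf]
  refine le_iInf₂ fun γ₂ h₂ => le_iInf₂ fun γ₁ h₁ => ?_
  have hfin₁ : IsFiniteMeasure γ₁ := by
    refine ⟨?_⟩
    rw [← Set.preimage_univ (f := Prod.snd), ← Measure.map_apply measurable_snd .univ, h₁.2]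
    exact measure_lt_top _ _
  have hfin₂ : IsFiniteMeasure γ₂ := by
    refine ⟨?_⟩
    rw [← Set.preimage_univ (f := Prod.fst), ← Measure.map_apply measurable_fst .univ, h₂.1]
    exact measure_lt_top _ _
  obtain ⟨Γ, hΓ₁, hΓ₂⟩ := exists_gluing γ₁ γ₂ (h₁.2.trans h₂.1.symm)
  have hm : Measurable fun z : (α × α) × α => (z.1.2, z.2) := by fun_prop
  have e₁ : ∫⁻ z, c z.1 z.2 ∂γ₁ = ∫⁻ z, c z.1.1 z.1.2 ∂Γ := by
    rw [← hΓ₁]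
    exact lintegral_map (f := fun z : α × α => c z.1 z.2) hc measurable_fst
  have e₂ : ∫⁻ z, c z.1 z.2 ∂γ₂ = ∫⁻ z, c z.1.2 z.2 ∂Γ := by
    rw [← hΓ₂]
    exact lintegral_map (f := fun z : α × α => c z.1 z.2) hc hm
  have hμ : Γ.map (fun z => z.1.1) = μ := by
    rw [← h₁.1, ← hΓ₁, Measure.map_map measurable_fst measurable_fst]; rfl
  have hρ : Γ.map (fun z => z.2) = ρ := by
    rw [← h₂.2, ← hΓ₂, Measure.map_map measurable_snd hm]; rfl
  change wasserstein1 c μ ρ ≤ _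
  have hadd := lintegral_add_left (μ := Γ) (f := fun z => c z.1.1 z.1.2)
    (hc.comp measurable_fst) (fun z => c z.1.2 z.2)
  rw [e₁, e₂, ← hadd, ← hμ, ← hρ]
  exact (wasserstein1_map_le_lintegral hc Γ (by fun_prop) (by fun_prop)).trans
    (lintegral_mono fun z => htri _ _ _)

/-! ### The ground metric on one-hot pairs -/

lemma groundCost_triangle (p : ℝ≥0∞) [Fact (1 ≤ p)] {𝒰 𝒱 : Type*} [Fintype 𝒰] [Fintype 𝒱]
    [DecidableEq 𝒰] [DecidableEq 𝒱] (x y z : 𝒰 × 𝒱) :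
    groundCost p x z ≤ groundCost p x y + groundCost p y z := by
  rw [groundCost, groundCost, groundCost, ← ENNReal.ofReal_add (norm_nonneg _) (norm_nonneg _)]
  exact ENNReal.ofReal_le_ofReal (norm_sub_le_norm_sub_add_norm_sub _ _ _)

/-- Changing one label of a pair moves its one-hot encoding in two coordinates, by one each. -/
lemma groundCost_le_of_fst_eq (p : ℝ≥0∞) [Fact (1 ≤ p)] {𝒰 𝒱 : Type*} [Fintype 𝒰] [Fintype 𝒱]
    [DecidableEq 𝒰] [DecidableEq 𝒱] (u : 𝒰) (v v' : 𝒱) :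
    groundCost p (u, v) (u, v') ≤
      if v = v' then 0 else ENNReal.ofReal ((2 : ℝ) ^ (1 / p.toReal)) := by
  split_ifs with h
  · simp [groundCost, h]
  refine ENNReal.ofReal_le_ofReal ?_
  have hinr : ∀ k : 𝒱, ‖(oneHotPair p (u, v) - oneHotPair p (u, v')) (Sum.inr k)‖ =
      (if k = v then 1 else 0) + (if k = v' then 1 else 0) := by
    intro k
    simp only [oneHotPair, PiLp.sub_apply, Sum.elim_inr, Pi.single_apply]
    by_cases h1 : k = v
    · have h2 : k ≠ v' := h1 ▸ h
      simp [h1, h]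
    · by_cases h2 : k = v' <;> simp [h1, h2]
      rw [if_neg (fun hh => h hh.symm)]; simp
  have hinl : ∀ k : 𝒰, ‖(oneHotPair p (u, v) - oneHotPair p (u, v')) (Sum.inl k)‖ = 0 := by
    intro k
    simp [oneHotPair]
  rcases eq_or_ne p ⊤ with rfl | hp
  · rw [PiLp.norm_eq_ciSup]
    refine Real.iSup_le (fun i => ?_) (by positivity)
    rcases i with k | k
    · rw [hinl]; positivity
    · rw [hinr]
      simp only [ENNReal.toReal_top, div_zero, Real.rpow_zero]
      split_ifs with h1 h2 <;> first | exact absurd (h1.symm.trans h2) h | norm_num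
  · have hp0 : 0 < p.toReal :=
      ENNReal.toReal_pos (zero_lt_one.trans_le (Fact.out : 1 ≤ p)).ne' hp
    rw [PiLp.norm_eq_sum hp0]
    refine Real.rpow_le_rpow (Finset.sum_nonneg fun i _ => by positivity) ?_ (by positivity)
    rw [Fintype.sum_sum_type]
    simp only [hinl, hinr, Real.zero_rpow hp0.ne', Finset.sum_const_zero, zero_add]
    have : ∀ k : 𝒱, ((if k = v then (1 : ℝ) else 0) + (if k = v' then 1 else 0)) ^ p.toReal =
        (if k = v then 1 else 0) + (if k = v' then 1 else 0) := by
      intro k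
      split_ifs with h1 h2 <;> first | exact absurd (h1.symm.trans h2) h | simp [hp0.ne']
    simp only [this, Finset.sum_add_distrib, Finset.sum_ite_eq', Finset.mem_univ, if_true]
    norm_num

/-! ### Replacing one variable in the Wasserstein dependency measure -/

/-- Couplings that keep `U` fixed and move `V'` to `V` show that both the joint law and the product
of the marginals move by at most `2 ^ (1 / p)` times the probability that `V` and `V'` differ. -/
lemma wassersteinDependency_le_add (p : ℝ≥0∞) [Fact (1 ≤ p)] {Ω 𝒰 𝒱 : Type*}
    [MeasurableSpace Ω] [Fintype 𝒰] [Fintype 𝒱] [DecidableEq 𝒰] [DecidableEq 𝒱]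
    [MeasurableSpace 𝒰] [MeasurableSpace 𝒱] [MeasurableSingletonClass 𝒰]
    [MeasurableSingletonClass 𝒱] (P : Measure Ω) [IsProbabilityMeasure P] {U : Ω → 𝒰}
    {V V' : Ω → 𝒱} (hU : Measurable U) (hV : Measurable V) (hV' : Measurable V') :
    wassersteinDependency p P U V ≤ wassersteinDependency p P U V' +
      2 * (ENNReal.ofReal ((2 : ℝ) ^ (1 / p.toReal)) * P {ω | V ω ≠ V' ω}) := by
  have : Nonempty Ω := nonempty_of_isProbabilityMeasure P
  have : Nonempty (𝒰 × 𝒱) := this.map fun ω => (U ω, V ω)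
  have hc : Measurable (Function.uncurry (groundCost p (𝒰 := 𝒰) (𝒱 := 𝒱))) :=
    measurable_of_finite _
  have htri := groundCost_triangle p (𝒰 := 𝒰) (𝒱 := 𝒱)
  have hne : MeasurableSet {ω | V ω ≠ V' ω} := (measurableSet_eq_fun hV hV').compl
  set K := ENNReal.ofReal ((2 : ℝ) ^ (1 / p.toReal)) with hK
  have hUV : IsProbabilityMeasure (P.map fun ω => (U ω, V' ω)) :=
    Measure.isProbabilityMeasure_map (by fun_prop)
  have hU1 : IsProbabilityMeasure (P.map U) := Measure.isProbabilityMeasure_map (by fun_prop)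
  have hV1' : IsProbabilityMeasure (P.map V') := Measure.isProbabilityMeasure_map (by fun_prop)
  have hcost : ∀ ω : Ω, (if V ω = V' ω then 0 else K) =
      {ω | V ω ≠ V' ω}.indicator (fun _ => K) ω := by
    intro ω
    simp [Set.indicator_apply]
  have hint : ∫⁻ ω, {ω | V ω ≠ V' ω}.indicator (fun _ => K) ω ∂P = K * P {ω | V ω ≠ V' ω} := by
    rw [lintegral_indicator_const hne]
  have hjoint : wasserstein1 (groundCost p) (P.map fun ω => (U ω, V ω))
      (P.map fun ω => (U ω, V' ω)) ≤ K * P {ω | V ω ≠ V' ω} := by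
    refine (wasserstein1_map_le_lintegral hc P (hU.prodMk hV) (hU.prodMk hV')).trans ?_
    rw [← hint]
    refine lintegral_mono fun ω => (groundCost_le_of_fst_eq p _ _ _).trans ?_
    rw [hcost ω]
  have hprod : wasserstein1 (groundCost p) ((P.map U).prod (P.map V'))
      ((P.map U).prod (P.map V)) ≤ K * P {ω | V ω ≠ V' ω} := by
    rw [Measure.map_prod_map _ _ hU hV', Measure.map_prod_map _ _ hU hV]
    refine (wasserstein1_map_le_lintegral hc _ (hU.prodMap hV') (hU.prodMap hV)).trans ?_
    rw [← hint, ← (measurePreserving_snd (μ := P) (ν := P)).lintegral_comp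
      (measurable_const.indicator hne)]
    refine lintegral_mono fun ω => (groundCost_le_of_fst_eq p _ _ _).trans ?_
    rw [← hcost ω.2, hK]
    simp only [eq_comm, le_refl]
  calc wassersteinDependency p P U V
      ≤ K * P {ω | V ω ≠ V' ω} + (wassersteinDependency p P U V' + K * P {ω | V ω ≠ V' ω}) := by
        refine (wasserstein1_triangle hc htri _ (P.map fun ω => (U ω, V' ω)) _).trans ?_
        refine add_le_add hjoint ?_
        exact (wasserstein1_triangle hc htri _ ((P.map U).prod (P.map V')) _).trans
          (add_le_add le_rfl hprod)
    _ = _ := by ring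

/-! ### The growth function -/

open Classical in
/-- The labellings of the points `x i` realised by the class `H`. -/
noncomputable def realizedPatterns {𝒳 ι : Type*} [Fintype ι] [DecidableEq ι]
    (H : Set (𝒳 → Bool)) (x : ι → 𝒳) :
    Finset (ι → Bool) :=
  {b | ∃ h ∈ H, ∀ i, h (x i) = b i}

/-- The Sauer-Shelah bound for the restriction of a class to finitely many, possibly repeated,
points: repetitions never help, since a shattered set of indices has distinct points. -/
lemma card_realizedPatterns_le {𝒳 ι : Type*} [Fintype ι] [DecidableEq ι] {H : Set (𝒳 → Bool)}
    {d : ℕ}   (hd : classVCDim H ≤ d) (x : ι → 𝒳) :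
    (realizedPatterns H x).card ≤ ∑ k ∈ Finset.Iic d, (Fintype.card ι).choose k := by
  classical
  let f : (ι → Bool) → Finset ι := fun b => {i | b i = true}
  have hf : Function.Injective f := by
    intro b b' h
    funext i
    have : i ∈ f b ↔ i ∈ f b' := by rw [h]
    rw [Bool.eq_iff_iff]
    simpa [f] using this
  set 𝒜 := (realizedPatterns H x).image f with h𝒜
  have hvc : 𝒜.vcDim ≤ d := by
    refine Finset.sup_le fun T hT => ?_
    rw [Finset.mem_shatterer] at hT
    have key : ∀ t ⊆ T, ∃ h ∈ H, ∀ i ∈ T, (h (x i) = true ↔ i ∈ t) := by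
      intro t ht
      obtain ⟨u, hu, hut⟩ := hT ht
      obtain ⟨b, hb, rfl⟩ := Finset.mem_image.1 hu
      obtain ⟨h, hh, hhb⟩ := (Finset.mem_filter.1 hb).2
      refine ⟨h, hh, fun i hi => ?_⟩
      rw [hhb, ← hut]
      simp [f, hi]
    have hinj : Set.InjOn x T := by
      intro i hi j hj hij
      obtain ⟨h, -, hh⟩ := key {i} (by simpa using hi)
      have h1 := (hh i hi).2 (by simp)
      rw [hij] at h1
      have := (hh j hj).1 h1
      exact (Finset.mem_singleton.1 this).symm
    have hsh : ClassShatters H (T.image x) := by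
      intro b
      obtain ⟨h, hh, hb⟩ := key {i ∈ T | b (x i) = true} (Finset.filter_subset _ _)
      refine ⟨h, hh, fun y hy => ?_⟩
      obtain ⟨i, hi, rfl⟩ := Finset.mem_image.1 hy
      rw [Bool.eq_iff_iff, hb i hi]
      simp [hi]
    have : ((T.image x).card : ℕ∞) ≤ d :=
      (le_iSup₂ (f := fun (s : Finset 𝒳) (_ : ClassShatters H s) => (s.card : ℕ∞)) _ hsh).trans hd
    rw [Finset.card_image_of_injOn hinj] at this
    exact_mod_cast this
  calc (realizedPatterns H x).card = 𝒜.card := (Finset.card_image_of_injective _ hf).symm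
    _ ≤ 𝒜.shatterer.card := Finset.card_le_card_shatterer _
    _ ≤ ∑ k ∈ Finset.Iic 𝒜.vcDim, (Fintype.card ι).choose k :=
        Finset.card_shatterer_le_sum_vcDim
    _ ≤ _ := Finset.sum_le_sum_of_subset (Finset.Iic_subset_Iic.2 hvc)

/-- For `d = 0` the logarithm is `log 0 = 0`, and both sides are `1`. -/
lemma sum_choose_le_exp {n d : ℕ} (hdn : d ≤ n) :
    ((∑ k ∈ Finset.Iic d, n.choose k : ℕ) : ℝ) ≤
      Real.exp (d * Real.log (Real.exp 1 * n / d)) := by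
  rcases Nat.eq_zero_or_pos d with rfl | hd
  · have : Finset.Iic 0 = ({0} : Finset ℕ) := by ext; simp
    simp [this]
  have hn : (0 : ℝ) < n := by exact_mod_cast hd.trans_le hdn
  have hd' : (0 : ℝ) < d := by exact_mod_cast hd
  have hexp : Real.exp (d * Real.log (Real.exp 1 * n / d)) = Real.exp d * (n / d : ℝ) ^ d := by
    rw [mul_comm, ← Real.rpow_def_of_pos (by positivity), Real.rpow_natCast, mul_div_assoc,
      mul_pow, ← Real.exp_nat_mul, mul_one]
  -- weight the `k`-th binomial coefficient by `(d / n) ^ k ≥ (d / n) ^ d`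
  have hq : (d / n : ℝ) ≤ 1 := (div_le_one hn).2 (by exact_mod_cast hdn)
  have hbin : (d / n : ℝ) ^ d * ∑ k ∈ Finset.Iic d, (n.choose k : ℝ) ≤ Real.exp d := by
    calc (d / n : ℝ) ^ d * ∑ k ∈ Finset.Iic d, (n.choose k : ℝ)
        = ∑ k ∈ Finset.Iic d, (d / n : ℝ) ^ d * n.choose k := Finset.mul_sum _ _ _
      _ ≤ ∑ k ∈ Finset.Iic d, (d / n : ℝ) ^ k * n.choose k := by
          refine Finset.sum_le_sum fun k hk => ?_
          exact mul_le_mul_of_nonneg_right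
            (pow_le_pow_of_le_one (by positivity) hq (Finset.mem_Iic.1 hk)) (by positivity)
      _ ≤ ∑ k ∈ Finset.range (n + 1), (d / n : ℝ) ^ k * n.choose k := by
          refine Finset.sum_le_sum_of_subset_of_nonneg (fun k hk => ?_)
            fun k _ _ => by positivity
          simp only [Finset.mem_Iic, Finset.mem_range] at hk ⊢
          omega
      _ = (d / n + 1 : ℝ) ^ n := by rw [add_pow]; simp
      _ ≤ Real.exp (d / n) ^ n := pow_le_pow_left₀ (by positivity) (Real.add_one_le_exp _) _
      _ = Real.exp d := by rw [← Real.exp_nat_mul, mul_div_cancel₀ _ hn.ne']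
  rw [hexp, Nat.cast_sum]
  have hinv : (n / d : ℝ) ^ d * (d / n : ℝ) ^ d = 1 := by
    rw [← mul_pow, div_mul_div_cancel₀ hd'.ne', div_self hn.ne', one_pow]
  calc ∑ k ∈ Finset.Iic d, (n.choose k : ℝ)
      = (n / d : ℝ) ^ d * ((d / n : ℝ) ^ d * ∑ k ∈ Finset.Iic d, (n.choose k : ℝ)) := by
        rw [← mul_assoc, hinv, one_mul]
    _ ≤ (n / d : ℝ) ^ d * Real.exp d := mul_le_mul_of_nonneg_left hbin (by positivity)
    _ = _ := mul_comm _ _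

/-! ### Random signs -/

/-- Hoeffding's inequality for sums with random signs, in counting form. -/
lemma card_sum_signs_ge_le {ι : Type*} [Fintype ι] [DecidableEq ι] [Nonempty ι] (c : ι → ℝ)
    (hc : ∀ i, |c i| ≤ 1) {t : ℝ} (ht : 0 ≤ t) :
    (Finset.card {σ : ι → Bool | t ≤ ∑ i, (if σ i then c i else -c i)} : ℝ) ≤
      2 ^ Fintype.card ι * Real.exp (-(t ^ 2 / (2 * Fintype.card ι))) := by
  set m : ℝ := (Fintype.card ι : ℝ) with hm
  have hm0 : 0 < m := Nat.cast_pos.2 Fintype.card_pos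
  -- the multiplier `t / m` minimises the exponent of the Chernoff bound
  set lam : ℝ := t / m with hlam
  set A : Finset (ι → Bool) := {σ | t ≤ ∑ i, (if σ i then c i else -c i)} with hA
  have hmgf : ∑ σ : ι → Bool, Real.exp (lam * ∑ i, (if σ i then c i else -c i)) ≤
      2 ^ Fintype.card ι * Real.exp (m * (lam ^ 2 / 2)) := by
    calc ∑ σ : ι → Bool, Real.exp (lam * ∑ i, (if σ i then c i else -c i))
        = ∑ σ : ι → Bool, ∏ i, Real.exp (lam * (if σ i then c i else -c i)) := by
          simp only [Finset.mul_sum, Real.exp_sum]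
      _ = ∏ i, ∑ b : Bool, Real.exp (lam * (if b then c i else -c i)) :=
          (Fintype.prod_sum fun i (b : Bool) => Real.exp (lam * (if b then c i else -c i))).symm
      _ = ∏ i, (2 * Real.cosh (lam * c i)) := by
          refine Finset.prod_congr rfl fun i _ => ?_
          rw [Fintype.sum_bool, Real.cosh_eq]
          simp only [if_true, Bool.false_eq_true, if_false, mul_neg]
          ring
      _ ≤ ∏ _i : ι, (2 * Real.exp (lam ^ 2 / 2)) := by
          refine Finset.prod_le_prod (fun i _ => by positivity) fun i _ => ?_
          refine mul_le_mul_of_nonneg_left ((Real.cosh_le_exp_half_sq _).trans ?_) (by norm_num)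
          rw [Real.exp_le_exp, mul_pow]
          have := (sq_le_one_iff_abs_le_one _).2 (hc i)
          nlinarith [sq_nonneg lam]
      _ = _ := by
          rw [Finset.prod_const, Finset.card_univ, mul_pow, ← Real.exp_nat_mul]
  have hlow : (A.card : ℝ) * Real.exp (lam * t) ≤
      ∑ σ : ι → Bool, Real.exp (lam * ∑ i, (if σ i then c i else -c i)) := by
    rw [← nsmul_eq_mul, ← Finset.sum_const]
    refine (Finset.sum_le_sum fun σ hσ => ?_).trans (Finset.sum_le_univ_sum_of_nonneg fun σ =>
      (Real.exp_pos (lam * ∑ i, (if σ i then c i else -c i))).le)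
    exact Real.exp_le_exp.2
      (mul_le_mul_of_nonneg_left (Finset.mem_filter.1 hσ).2 (by positivity))
  have hexp : -(t ^ 2 / (2 * m)) = m * (lam ^ 2 / 2) - lam * t := by
    rw [hlam]; field_simp; ring
  rw [hexp, Real.exp_sub, ← mul_div_assoc, le_div_iff₀ (Real.exp_pos _)]
  exact hlow.trans hmgf

/-! ### Double samples and swaps -/

lemma measurePreserving_comp_equiv {Z J J' : Type*} [MeasurableSpace Z] [Fintype J] [Fintype J']
    (μ : Measure Z) [SigmaFinite μ] (e : J' ≃ J) :
    MeasurePreserving (fun z : J → Z => z ∘ e) (Measure.pi fun _ => μ)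
      (Measure.pi fun _ => μ) := by
  convert! measurePreserving_piCongrLeft (α := fun _ : J' => Z) (fun _ => μ) e.symm using 1
  ext z j
  simp [MeasurableEquiv.coe_piCongrLeft, Equiv.piCongrLeft, Equiv.piCongrLeft']

/-- The measurability condition on the class transfers to labelled samples with an arbitrary finite
index type. -/
lemma MeasurableClass.nullMeasurableSet_pattern {𝒳 J : Type*} [MeasurableSpace 𝒳] [Fintype J]
    (μ : Measure (𝒳 × Bool)) [IsProbabilityMeasure μ] {H : Set (𝒳 → Bool)}
    (hH : MeasurableClass (μ.map Prod.fst) H) (b : J → Bool) :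
    NullMeasurableSet {z : J → 𝒳 × Bool | ∃ h ∈ H, ∀ j, h (z j).1 = b j}
      (Measure.pi fun _ => μ) := by
  have hprob : IsProbabilityMeasure (μ.map Prod.fst) :=
    Measure.isProbabilityMeasure_map (by fun_prop)
  let e := Fintype.equivFin J
  have h1 : MeasurePreserving (fun (z : J → 𝒳 × Bool) j => (z j).1) (Measure.pi fun _ => μ)
      (Measure.pi fun _ => μ.map Prod.fst) :=
    measurePreserving_pi _ _ fun _ => measurable_fst.measurePreserving μ
  have h2 : MeasurePreserving (fun (x : J → 𝒳) => x ∘ e.symm)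
      (Measure.pi fun _ => μ.map Prod.fst) (Measure.pi fun _ => μ.map Prod.fst) :=
    measurePreserving_comp_equiv _ e.symm
  convert! (hH.2 _ (b ∘ e.symm)).preimage (h2.comp h1).quasiMeasurePreserving using 1
  ext z
  simp only [Set.mem_ofPred_eq, Set.mem_preimage, Function.comp_apply]
  exact exists_congr fun h => and_congr_right fun _ => (e.symm.forall_congr_right).symm

/-- The double samples on which some member of `H` has an empirical risk on the second half that
exceeds the one on the first half by at least `τ`. -/
def riskGapEvent {𝒳 : Type*} (H : Set (𝒳 → Bool)) (m : ℕ) (τ : ℝ) :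
    Set (Fin m ⊕ Fin m → 𝒳 × Bool) :=
  {z | ∃ h ∈ H, empiricalRisk (z ∘ Sum.inl) h + τ ≤ empiricalRisk (z ∘ Sum.inr) h}

lemma nullMeasurableSet_riskGapEvent {𝒳 : Type*} [MeasurableSpace 𝒳]
    (μ : Measure (𝒳 × Bool)) [IsProbabilityMeasure μ]
    {H : Set (𝒳 → Bool)} (hH : MeasurableClass (μ.map Prod.fst) H) (m : ℕ) (τ : ℝ) :
    NullMeasurableSet (riskGapEvent H m τ) (Measure.pi fun _ => μ) := by
  -- given the labelling `b` that `h` realises on the double sample, the gap depends on `b` alone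
  have heq : riskGapEvent H m τ = ⋃ b : Fin m ⊕ Fin m → Bool,
      {z | ∃ h ∈ H, ∀ j, h (z j).1 = b j} ∩
      {z | (∑ i, if b (Sum.inl i) ≠ (z (Sum.inl i)).2 then (1 : ℝ) else 0) / m + τ ≤
        (∑ i, if b (Sum.inr i) ≠ (z (Sum.inr i)).2 then (1 : ℝ) else 0) / m} := by
    ext z
    simp only [riskGapEvent, empiricalRisk, Set.mem_ofPred_eq, Set.mem_iUnion, Set.mem_inter_iff,
      Function.comp_apply]
    constructor
    · rintro ⟨h, hh, hgap⟩
      exact ⟨fun j => h (z j).1, ⟨h, hh, fun _ => rfl⟩, hgap⟩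
    · rintro ⟨b, ⟨h, hh, hb⟩, hgap⟩
      refine ⟨h, hh, ?_⟩
      simpa only [hb] using hgap
  rw [heq]
  refine NullMeasurableSet.iUnion fun b => (hH.nullMeasurableSet_pattern μ b).inter ?_
  have hm : ∀ j, Measurable fun z : Fin m ⊕ Fin m → 𝒳 × Bool =>
      if b j ≠ (z j).2 then (1 : ℝ) else 0 := fun j =>
    (measurable_of_finite fun a : Bool => if b j ≠ a then (1 : ℝ) else 0).comp
      (measurable_snd.comp (measurable_pi_apply j))
  refine (measurableSet_le ?_ ?_).nullMeasurableSet
  · exact ((Finset.measurable_sum _ fun i _ => hm (Sum.inl i)).div_const _).add_const _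
  · exact (Finset.measurable_sum _ fun i _ => hm (Sum.inr i)).div_const _

/-- The permutation of a double sample that exchanges the two copies of the `i`-th example
whenever `σ i` is false. -/
def swapPerm {ι : Type*} (σ : ι → Bool) : Equiv.Perm (ι ⊕ ι) :=
  Function.Involutive.toPerm
    (Sum.elim (fun i => if σ i then Sum.inl i else Sum.inr i)
      (fun i => if σ i then Sum.inr i else Sum.inl i)) (by
    rintro (i | i) <;> cases h : σ i <;> simp [h])

@[simp] lemma swapPerm_inl {ι : Type*} (σ : ι → Bool) (i : ι) :
    swapPerm σ (Sum.inl i) = if σ i then Sum.inl i else Sum.inr i := rfl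

@[simp] lemma swapPerm_inr {ι : Type*} (σ : ι → Bool) (i : ι) :
    swapPerm σ (Sum.inr i) = if σ i then Sum.inr i else Sum.inl i := rfl

open Classical in
/-- For a fixed double sample, few swaps produce a gap: `H` realises few labellings on it, and each
of them is handled by Hoeffding's inequality for random signs. -/
lemma card_swap_mem_riskGapEvent_le {𝒳 : Type*} (H : Set (𝒳 → Bool)) {m : ℕ} (hm : 0 < m)
    {τ : ℝ} (hτ : 0 ≤ τ) (z : Fin m ⊕ Fin m → 𝒳 × Bool) :
    (Finset.card {σ : Fin m → Bool | z ∘ swapPerm σ ∈ riskGapEvent H m τ} : ℝ) ≤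
      (realizedPatterns H fun j => (z j).1).card *
        (2 ^ m * Real.exp (-(m * τ ^ 2 / 2))) := by
  have : Nonempty (Fin m) := ⟨⟨0, hm⟩⟩
  have hm' : (0 : ℝ) < m := by exact_mod_cast hm
  let c : (Fin m ⊕ Fin m → Bool) → Fin m → ℝ := fun b i =>
    (if b (Sum.inr i) ≠ (z (Sum.inr i)).2 then (1 : ℝ) else 0) -
      (if b (Sum.inl i) ≠ (z (Sum.inl i)).2 then (1 : ℝ) else 0)
  let F : (Fin m ⊕ Fin m → Bool) → Finset (Fin m → Bool) := fun b =>
    {σ | m * τ ≤ ∑ i, (if σ i then c b i else -c b i)}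
  have hsub : ({σ : Fin m → Bool | z ∘ swapPerm σ ∈ riskGapEvent H m τ} : Finset _) ⊆
      (realizedPatterns H fun j => (z j).1).biUnion F := by
    intro σ hσ
    obtain ⟨h, hh, hgap⟩ := (Finset.mem_filter.1 hσ).2
    refine Finset.mem_biUnion.2 ⟨fun j => h (z j).1,
      Finset.mem_filter.2 ⟨Finset.mem_univ _, h, hh, fun _ => rfl⟩,
      Finset.mem_filter.2 ⟨Finset.mem_univ _, ?_⟩⟩
    rw [empiricalRisk, empiricalRisk, ← le_sub_iff_add_le', ← sub_div, le_div_iff₀ hm',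
      ← Finset.sum_sub_distrib, mul_comm] at hgap
    refine hgap.trans_eq (Finset.sum_congr rfl fun i _ => ?_)
    cases hs : σ i <;> simp [c, hs]
  have hF : ∀ b, ((F b).card : ℝ) ≤ 2 ^ m * Real.exp (-(m * τ ^ 2 / 2)) := by
    intro b
    have h1 := card_sum_signs_ge_le (c b) (fun i => by
      simp only [c]; split_ifs <;> norm_num) (t := m * τ) (by positivity)
    rw [Fintype.card_fin] at h1
    convert h1 using 3
    field_simp
  calc (Finset.card {σ : Fin m → Bool | z ∘ swapPerm σ ∈ riskGapEvent H m τ} : ℝ)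
      ≤ (∑ b ∈ realizedPatterns H fun j => (z j).1, (F b).card : ℕ) := by
        exact_mod_cast (Finset.card_le_card hsub).trans Finset.card_biUnion_le
    _ ≤ ∑ b ∈ realizedPatterns H fun j => (z j).1, 2 ^ m * Real.exp (-(m * τ ^ 2 / 2)) := by
        rw [Nat.cast_sum]
        exact Finset.sum_le_sum fun b _ => hF b
    _ = _ := by rw [Finset.sum_const, nsmul_eq_mul]

/-- The law of a double sample is invariant under swaps, so the probability of a gap is the average
over the double samples of the proportion of swaps that produce one. -/
lemma measure_riskGapEvent_le {𝒳 : Type*} [MeasurableSpace 𝒳]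
    (μ : Measure (𝒳 × Bool)) [IsProbabilityMeasure μ]
    {H : Set (𝒳 → Bool)} (hH : MeasurableClass (μ.map Prod.fst) H) {d : ℕ}
    (hd : classVCDim H ≤ d) {m : ℕ} (hm : 0 < m) {τ : ℝ} (hτ : 0 ≤ τ) :
    (Measure.pi fun _ => μ) (riskGapEvent H m τ) ≤
      ENNReal.ofReal ((∑ k ∈ Finset.Iic d, (2 * m).choose k : ℕ) *
        Real.exp (-(m * τ ^ 2 / 2))) := by
  classical
  set D := riskGapEvent H m τ with hD
  set ν : Measure (Fin m ⊕ Fin m → 𝒳 × Bool) := Measure.pi fun _ => μ with hν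
  set G : ℕ := ∑ k ∈ Finset.Iic d, (2 * m).choose k with hG
  set x := Real.exp (-(m * τ ^ 2 / 2)) with hx
  have hnull : ∀ σ : Fin m → Bool, NullMeasurableSet ((fun z => z ∘ swapPerm σ) ⁻¹' D) ν :=
    fun σ => (nullMeasurableSet_riskGapEvent μ hH m τ).preimage
      (measurePreserving_comp_equiv μ (swapPerm σ)).quasiMeasurePreserving
  have hcount : ∀ z, ∑ σ : Fin m → Bool, ((fun z => z ∘ swapPerm σ) ⁻¹' D).indicator 1 z ≤
      ENNReal.ofReal (2 ^ m * (G * x)) := by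
    intro z
    have hcard : ∑ σ : Fin m → Bool, ((fun z => z ∘ swapPerm σ) ⁻¹' D).indicator 1 z =
        ENNReal.ofReal (Finset.card {σ : Fin m → Bool | z ∘ swapPerm σ ∈ D} : ℝ) := by
      rw [ENNReal.ofReal_natCast, Finset.card_filter, Nat.cast_sum]
      refine Finset.sum_congr rfl fun σ _ => ?_
      simp [Set.indicator_apply]
    rw [hcard]
    refine ENNReal.ofReal_le_ofReal ((card_swap_mem_riskGapEvent_le H hm hτ z).trans ?_)
    have hpat : ((realizedPatterns H fun j => (z j).1).card : ℝ) ≤ G := by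
      have := card_realizedPatterns_le hd fun j => (z j).1
      rw [Fintype.card_sum, Fintype.card_fin, ← two_mul] at this
      exact_mod_cast this
    calc _ ≤ (G : ℝ) * (2 ^ m * x) := mul_le_mul_of_nonneg_right hpat (by positivity)
      _ = _ := by ring
  have hsum : (2 ^ m : ℝ≥0∞) * ν D ≤ ENNReal.ofReal (2 ^ m * (G * x)) := by
    calc (2 ^ m : ℝ≥0∞) * ν D
        = ∑ σ : Fin m → Bool, ν ((fun z => z ∘ swapPerm σ) ⁻¹' D) := by
          rw [Finset.sum_congr rfl fun σ _ =>
            (measurePreserving_comp_equiv μ (swapPerm σ)).measure_preimage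
              (nullMeasurableSet_riskGapEvent μ hH m τ)]
          simp [hν, hD]
      _ = ∑ σ : Fin m → Bool, ∫⁻ z, ((fun z => z ∘ swapPerm σ) ⁻¹' D).indicator 1 z ∂ν :=
          Finset.sum_congr rfl fun σ _ => (lintegral_indicator_one₀ (hnull σ)).symm
      _ = ∫⁻ z, ∑ σ : Fin m → Bool, ((fun z => z ∘ swapPerm σ) ⁻¹' D).indicator 1 z ∂ν :=
          (lintegral_finsetSum' _ fun σ _ => aemeasurable_one.indicator₀ (hnull σ)).symm
      _ ≤ ∫⁻ _, ENNReal.ofReal (2 ^ m * (G * x)) ∂ν := lintegral_mono hcount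
      _ = _ := by simp
  rw [ENNReal.ofReal_mul (by positivity), ENNReal.ofReal_pow (by norm_num),
    ENNReal.ofReal_ofNat] at hsum
  exact (ENNReal.mul_le_mul_iff_right (by simp) (by simp)).1 hsum

/-! ### Symmetrization -/

/-- The true risk of `h` for the 0-1 loss: the probability of a wrong label. -/
noncomputable def trueRisk {𝒳 : Type*} [MeasurableSpace 𝒳] (μ : Measure (𝒳 × Bool))
    (h : 𝒳 → Bool) : ℝ :=
  μ.real {z | h z.1 ≠ z.2}

lemma measurable_empiricalRisk {𝒳 : Type*} [MeasurableSpace 𝒳] {m : ℕ} {h : 𝒳 → Bool}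
    (hh : Measurable h) :
    Measurable fun s : Fin m → 𝒳 × Bool => empiricalRisk s h := by
  refine (Finset.measurable_sum _ fun i _ => ?_).div_const _
  exact (measurable_of_finite fun a : Bool × Bool => if a.1 ≠ a.2 then (1 : ℝ) else 0).comp
    (f := fun s : Fin m → 𝒳 × Bool => (h (s i).1, (s i).2)) (by fun_prop)

/-- The empirical risk of a single function on a fresh sample is at least its true risk minus `η`
with probability at least one half, by Hoeffding's inequality. -/
lemma half_le_measure_trueRisk_sub_le {𝒳 : Type*} [MeasurableSpace 𝒳]
    (μ : Measure (𝒳 × Bool)) [IsProbabilityMeasure μ]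
    {h : 𝒳 → Bool} (hh : Measurable h) {m : ℕ} (hm : 0 < m) {η : ℝ} (hη : 0 ≤ η)
    (hmη : Real.log 2 ≤ 2 * m * η ^ 2) :
    (2⁻¹ : ℝ≥0∞) ≤ (Measure.pi fun _ : Fin m => μ) {s | trueRisk μ h - η ≤ empiricalRisk s h} := by
  have hm' : (0 : ℝ) < m := by exact_mod_cast hm
  set ν : Measure (Fin m → 𝒳 × Bool) := Measure.pi fun _ => μ with hν
  let g : 𝒳 × Bool → ℝ := fun z => -(if h z.1 ≠ z.2 then (1 : ℝ) else 0)
  have hset : MeasurableSet {z : 𝒳 × Bool | h z.1 ≠ z.2} :=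
    (measurableSet_eq_fun (hh.comp measurable_fst) measurable_snd).compl
  have hg : Measurable g := (Measurable.ite hset measurable_const measurable_const).neg
  have hgint : ∫ z, g z ∂μ = -trueRisk μ h := by
    have : g = fun z => -({z : 𝒳 × Bool | h z.1 ≠ z.2}.indicator 1 z) := by
      ext z; simp [g, Set.indicator_apply]
    rw [this, integral_neg, integral_indicator_one hset, trueRisk]
  have hmean : ∀ i : Fin m, ∫ s, g (s i) ∂ν = -trueRisk μ h := by
    intro i
    rw [← hgint]
    have := (measurePreserving_eval (fun _ : Fin m => μ) i)
    rw [← this.map_eq, integral_map this.measurable.aemeasurable hg.aestronglyMeasurable]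
  have hsub : ∀ i ∈ Finset.univ, HasSubgaussianMGF (fun s : Fin m → 𝒳 × Bool =>
      g (s i) + trueRisk μ h) (4⁻¹) ν := by
    intro i _
    have := hasSubgaussianMGF_of_mem_Icc (μ := ν) (X := fun s => g (s i)) (a := -1) (b := 0)
      (hg.comp (measurable_pi_apply i)).aemeasurable (Filter.Eventually.of_forall fun s => by
        simp only [g]; split_ifs <;> simp)
    rw [hmean i] at this
    convert this using 1
    · ext; simp
    · ext; norm_num
  have hind : iIndepFun (fun (i : Fin m) (s : Fin m → 𝒳 × Bool) => g (s i) + trueRisk μ h) ν :=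
    iIndepFun_pi (μ := fun _ : Fin m => μ) (X := fun _ z => g z + trueRisk μ h)
      fun _ => (hg.add_const _).aemeasurable
  have hoeff := HasSubgaussianMGF.measure_sum_ge_le_of_iIndepFun hind hsub
    (ε := m * η) (by positivity)
  have hbound : ν.real {s | m * η ≤ ∑ i, (g (s i) + trueRisk μ h)} ≤ 2⁻¹ := by
    refine hoeff.trans ?_
    rw [← Real.exp_log (show (0 : ℝ) < 2⁻¹ by norm_num), Real.exp_le_exp, Real.log_inv]
    have : -(m * η) ^ 2 / (2 * ((∑ _i : Fin m, (4⁻¹ : NNReal) : NNReal) : ℝ)) =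
        -(2 * m * η ^ 2) := by
      simp only [Finset.sum_const, Finset.card_univ, Fintype.card_fin, nsmul_eq_mul]
      push_cast
      field_simp
      ring
    rw [this]
    linarith
  have hE : MeasurableSet {s : Fin m → 𝒳 × Bool | trueRisk μ h - η ≤ empiricalRisk s h} :=
    measurableSet_le measurable_const (measurable_empiricalRisk hh)
  have hcompl : ν.real {s | trueRisk μ h - η ≤ empiricalRisk s h}ᶜ ≤ 2⁻¹ := by
    refine (measureReal_mono fun s hs => ?_).trans hbound
    simp only [Set.mem_compl_iff, Set.mem_ofPred_eq, not_le] at hs ⊢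
    have hsum : ∑ i, (g (s i) + trueRisk μ h) = m * (trueRisk μ h - empiricalRisk s h) := by
      rw [Finset.sum_add_distrib, Finset.sum_neg_distrib, empiricalRisk]
      simp only [Finset.sum_const, Finset.card_univ, Fintype.card_fin, nsmul_eq_mul]
      field_simp
      ring
    rw [hsum]
    exact mul_le_mul_of_nonneg_left (by linarith) hm'.le
  rw [probReal_compl_eq_one_sub hE] at hcompl
  have : (2⁻¹ : ℝ) ≤ ν.real {s | trueRisk μ h - η ≤ empiricalRisk s h} := by linarith
  rw [Measure.real, ← ENNReal.ofReal_le_iff_le_toReal (measure_ne_top _ _)] at this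
  refine le_trans ?_ this
  rw [ENNReal.ofReal_inv_of_pos (by norm_num)]; simp

/-- Symmetrization. The event on the left need not be measurable, since the true risk is not
determined by labellings of finitely many points; the bound is for its outer measure. -/
lemma measure_exists_trueRisk_gt_le {𝒳 : Type*} [MeasurableSpace 𝒳]
    (μ : Measure (𝒳 × Bool)) [IsProbabilityMeasure μ]
    {H : Set (𝒳 → Bool)} (hH : MeasurableClass (μ.map Prod.fst) H) {m : ℕ} (hm : 0 < m)
    {η τ : ℝ} (hη : 0 ≤ η) (hmη : Real.log 2 ≤ 2 * m * η ^ 2) :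
    (Measure.pi fun _ => μ)
        {s : Fin m → 𝒳 × Bool | ∃ h ∈ H, empiricalRisk s h + (τ + η) < trueRisk μ h} ≤
      2 * (Measure.pi fun _ => μ) (riskGapEvent H m τ) := by
  set ν : Measure (Fin m → 𝒳 × Bool) := Measure.pi fun _ => μ with hν
  let e := MeasurableEquiv.sumPiEquivProdPi fun _ : Fin m ⊕ Fin m => 𝒳 × Bool
  have he : MeasurePreserving e.symm (ν.prod ν) (Measure.pi fun _ => μ) :=
    measurePreserving_sumPiEquivProdPi_symm fun _ : Fin m ⊕ Fin m => μ
  set D : Set ((Fin m → 𝒳 × Bool) × (Fin m → 𝒳 × Bool)) := e.symm ⁻¹' riskGapEvent H m τ with hD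
  have hDmeas : (ν.prod ν) D = (Measure.pi fun _ => μ) (riskGapEvent H m τ) :=
    he.measure_preimage_equiv _
  -- a measurable superset of the gap event of the same measure, to which Fubini's theorem applies
  set T := toMeasurable (ν.prod ν) D with hT
  have hTm : MeasurableSet T := measurableSet_toMeasurable _ _
  have hsec : ∀ s ∈ {s : Fin m → 𝒳 × Bool | ∃ h ∈ H, empiricalRisk s h + (τ + η) < trueRisk μ h},
      (2⁻¹ : ℝ≥0∞) ≤ ν (Prod.mk s ⁻¹' T) := by
    rintro s ⟨h, hh, hs⟩
    refine (half_le_measure_trueRisk_sub_le μ (hH.1 h hh) hm hη hmη).trans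
      (measure_mono fun s' hs' => subset_toMeasurable _ _ ?_)
    refine ⟨h, hh, ?_⟩
    change empiricalRisk s h + τ ≤ empiricalRisk s' h
    have : trueRisk μ h - η ≤ empiricalRisk s' h := hs'
    linarith
  have hmarkov := mul_meas_ge_le_lintegral (μ := ν) (measurable_measure_prodMk_left (ν := ν) hTm)
    2⁻¹
  rw [← Measure.prod_apply hTm, hT, measure_toMeasurable, hDmeas] at hmarkov
  calc ν _ = 2 * (2⁻¹ * ν _) := by
        rw [← mul_assoc, ENNReal.mul_inv_cancel (by simp) (by simp), one_mul]
    _ ≤ _ := by gcongr; exact (mul_le_mul_right (measure_mono hsec) _).trans hmarkov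

/-! ### The uniform risk bound -/

/-- The generalisation bound for classes of VC dimension at most `d`. A quarter of the deviation is
spent on the fluctuation of the second sample in the symmetrization, three quarters on the gap
between the two halves of the double sample. -/
lemma measure_exists_trueRisk_gt_le_delta {𝒳 : Type*} [MeasurableSpace 𝒳]
    (μ : Measure (𝒳 × Bool)) [IsProbabilityMeasure μ] {H : Set (𝒳 → Bool)}
    (hH : MeasurableClass (μ.map Prod.fst) H) {d : ℕ} (hd : classVCDim H ≤ d) {m : ℕ}
    (hm : 0 < m) (hdm : d ≤ 2 * m) {δ : ℝ} (hδ0 : 0 < δ) (hδ1 : δ < 1) :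
    (Measure.pi fun _ => μ) {s : Fin m → 𝒳 × Bool | ∃ h ∈ H, empiricalRisk s h +
        Real.sqrt (4 / m * (d * Real.log (2 * Real.exp 1 * m / d) + Real.log (4 / δ))) <
          trueRisk μ h} ≤ ENNReal.ofReal δ := by
  have hm' : (0 : ℝ) < m := by exact_mod_cast hm
  set L := d * Real.log (2 * Real.exp 1 * m / d) with hL
  set l := Real.log (4 / δ) with hl
  set ε := Real.sqrt (4 / m * (L + l)) with hε
  have hgrowth : ((∑ k ∈ Finset.Iic d, (2 * m).choose k : ℕ) : ℝ) ≤ Real.exp L := by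
    convert sum_choose_le_exp hdm using 4
    push_cast
    ring
  have hL0 : 0 ≤ L := by
    rw [← Real.one_le_exp_iff]
    refine le_trans ?_ hgrowth
    have h0 : (0 : ℕ) ∈ Finset.Iic d := by simp
    have h1 := Finset.single_le_sum (f := fun k => (2 * m).choose k) (fun _ _ => Nat.zero_le _) h0
    simp only [Nat.choose_zero_right] at h1
    exact_mod_cast h1
  have hl2 : 2 * Real.log 2 ≤ l := by
    have : 2 * Real.log 2 = Real.log 4 := by
      rw [show (4 : ℝ) = 2 ^ 2 by norm_num, Real.log_pow]; norm_num
    rw [this]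
    refine Real.log_le_log (by norm_num) ?_
    rw [le_div_iff₀ hδ0]
    linarith
  have hlog2 : 0 < Real.log 2 := Real.log_pos (by norm_num)
  have hε2 : m * ε ^ 2 = 4 * (L + l) := by
    have hLl : 0 ≤ L + l := by linarith
    rw [hε, Real.sq_sqrt (by positivity)]
    field_simp
  have hε0 : 0 ≤ ε := Real.sqrt_nonneg _
  have hsym := measure_exists_trueRisk_gt_le μ hH hm (η := ε / 4) (τ := 3 * ε / 4) (by positivity)
    (by rw [show 2 * m * (ε / 4) ^ 2 = m * ε ^ 2 / 8 by ring, hε2]; linarith)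
  rw [show 3 * ε / 4 + ε / 4 = ε by ring] at hsym
  refine hsym.trans ((mul_le_mul_right
    (measure_riskGapEvent_le μ hH hd hm (by positivity)) 2).trans ?_)
  rw [← ENNReal.ofReal_ofNat, ← ENNReal.ofReal_mul (by norm_num)]
  refine ENNReal.ofReal_le_ofReal ?_
  have hexp : Real.exp (-(m * (3 * ε / 4) ^ 2 / 2)) ≤ Real.exp (-(L + l)) := by
    rw [Real.exp_le_exp, show m * (3 * ε / 4) ^ 2 / 2 = m * ε ^ 2 * (9 / 32) by ring, hε2]
    linarith
  have hδ : Real.exp L * Real.exp (-(L + l)) = δ / 4 := by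
    rw [← Real.exp_add, show L + -(L + l) = -l by ring, Real.exp_neg, hl,
      Real.exp_log (by positivity), inv_div]
  calc 2 * (_ * Real.exp (-(m * (3 * ε / 4) ^ 2 / 2)))
      ≤ 2 * (Real.exp L * Real.exp (-(L + l))) := by gcongr
    _ ≤ δ := by rw [hδ]; linarith

theorem theorem3
    {Ω Ω' 𝒳 𝒴 : Type*} [MeasurableSpace Ω] [MeasurableSpace Ω'] [MeasurableSpace 𝒳]
    [Fintype 𝒴] [DecidableEq 𝒴] [MeasurableSpace 𝒴] [MeasurableSingletonClass 𝒴]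
    -- the population: an example `X` and its sensitive attribute `A`
    (P : Measure Ω) [IsProbabilityMeasure P]
    (X : Ω → 𝒳) (hX : Measurable X) (A : Ω → Bool) (hA : Measurable A)
    -- the ground norm
    (p : ℝ≥0∞) [Fact (1 ≤ p)]
    -- the hypothesis class
    (H : Set (𝒳 → Bool)) (hH : MeasurableClass (P.map X) H) (d : ℕ) (hd : classVCDim H = d)
    -- the i.i.d. training sample
    (m : ℕ) (hm : 0 < m) (hdm : d ≤ 2 * m)
    (Q : Measure Ω') [IsProbabilityMeasure Q] (S : Fin m → Ω' → 𝒳 × Bool)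
    (hindep : iIndepFun S Q)
    (hident : ∀ i, IdentDistrib (S i) (fun ω => (X ω, A ω)) Q P)
    (δ : ℝ) (hδ0 : 0 < δ) (hδ1 : δ < 1) :
    ∃ E : Set Ω', MeasurableSet E ∧ ENNReal.ofReal (1 - δ) ≤ Q E ∧
      ∀ ω' ∈ E, ∀ h ∈ H, ∀ Yhat : Ω → 𝒴, Measurable Yhat →
        wassersteinDependency p P Yhat A ≤
          wassersteinDependency p P Yhat (fun ω => h (X ω)) +
            ENNReal.ofReal (2 * (2 : ℝ) ^ (1 / p.toReal) *
              (empiricalRisk (fun i => S i ω') h +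
                Real.sqrt (4 / m *
                  (d * Real.log (2 * Real.exp 1 * m / d) + Real.log (4 / δ))))) := by
  have hXA : Measurable fun ω => (X ω, A ω) := hX.prodMk hA
  set μ : Measure (𝒳 × Bool) := P.map fun ω => (X ω, A ω) with hμ
  have hμprob : IsProbabilityMeasure μ := Measure.isProbabilityMeasure_map hXA.aemeasurable
  have hfst : μ.map Prod.fst = P.map X := by
    rw [hμ, Measure.map_map measurable_fst hXA]; rfl
  have hSm : ∀ i, AEMeasurable (S i) Q := fun i => (hident i).aemeasurable_fst
  have hSm' : AEMeasurable (fun ω' i => S i ω') Q := aemeasurable_pi_lambda _ hSm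
  have hlaw : Q.map (fun ω' i => S i ω') = Measure.pi fun _ => μ := by
    rw [(iIndepFun_iff_map_fun_eq_pi_map hSm).1 hindep]
    congr 1
    ext1 i
    exact (hident i).map_eq
  set ε := Real.sqrt (4 / m * (d * Real.log (2 * Real.exp 1 * m / d) + Real.log (4 / δ))) with hε
  set B : Set (Fin m → 𝒳 × Bool) := {s | ∃ h ∈ H, empiricalRisk s h + ε < trueRisk μ h} with hB
  have hBδ : (Measure.pi fun _ => μ) B ≤ ENNReal.ofReal δ :=
    measure_exists_trueRisk_gt_le_delta μ (hfst ▸ hH) hd.le hm hdm hδ0 hδ1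
  -- `B` may fail to be measurable, and the sample is only a.e. measurable
  set T := toMeasurable (Measure.pi fun _ => μ) B with hT
  have hTm : MeasurableSet T := measurableSet_toMeasurable _ _
  have hnull : NullMeasurableSet ((fun ω' i => S i ω') ⁻¹' T) Q :=
    hSm'.nullMeasurable hTm
  obtain ⟨E, hEsub, hEm, hEeq⟩ := hnull.compl.exists_measurable_subset_ae_eq
  refine ⟨E, hEm, ?_, ?_⟩
  · rw [measure_congr hEeq, prob_compl_eq_one_sub₀ hnull,
      ← Measure.map_apply_of_aemeasurable hSm' hTm, hlaw, hT, measure_toMeasurable,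
      ENNReal.ofReal_sub _ hδ0.le, ENNReal.ofReal_one]
    exact tsub_le_tsub_left hBδ _
  intro ω' hω' h hh Yhat hY
  have hrisk : trueRisk μ h ≤ empiricalRisk (fun i => S i ω') h + ε := by
    by_contra hlt
    exact hEsub hω' (subset_toMeasurable _ _ ⟨h, hh, not_le.1 hlt⟩)
  have hhm := hH.1 h hh
  have hdiff : P {ω | A ω ≠ h (X ω)} = ENNReal.ofReal (trueRisk μ h) := by
    have hset : MeasurableSet {z : 𝒳 × Bool | h z.1 ≠ z.2} :=
      (measurableSet_eq_fun (hhm.comp measurable_fst) measurable_snd).compl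
    rw [trueRisk, ofReal_measureReal, hμ, Measure.map_apply hXA hset]
    simp only [Set.preimage_ofPred_eq, ne_comm]
  refine (wassersteinDependency_le_add p P hY hA (hhm.comp hX)).trans (add_le_add le_rfl ?_)
  change 2 * (ENNReal.ofReal ((2 : ℝ) ^ (1 / p.toReal)) * P {ω | A ω ≠ h (X ω)}) ≤ _
  rw [hdiff, ← ENNReal.ofReal_mul (by positivity), ← ENNReal.ofReal_ofNat,
    ← ENNReal.ofReal_mul (by norm_num), ← mul_assoc]
  exact ENNReal.ofReal_le_ofReal (mul_le_mul_of_nonneg_left hrisk (by positivity))
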